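/- Let $M,K,N,L\ge 1$ be integers with $K\ge M$. Let $\mathbf H_1,\dots,\mathbf H_M\in\mathbb C^{K\times M}$ be random matrices whose entries are all jointly independent $\mathcal{CN}(0,1)$ variables (circularly symmetric). Let $\mathbf R\in\mathbb C^{M\times M}$ be Hermitian positive definite with eigendecomposition $\mathbf R=\mathbf U\,\mathrm{diag}(\lambda_1,\dots,\lambda_M)\,\mathbf U^{\mathsf H}$, $\mathbf U$ unitary with columns $\mathbf u_1,\dots,\mathbf u_M$. Let $\mathbf v_m=\mathbf q_m/\lVert\mathbf q_m\rVert$, where $\mathbf q_m$ is the $m$-th column of $\mathbf P_m(\mathbf P_m^{\mathsf H}\mathbf P_m)^{-1}$ with $\mathbf P_m=\mathbf H_m\mathbf U$, and $\rho_m=|\mathbf v_m^{\mathsf H}\mathbf H_m\mathbf u_m|^2$. For a power allocation $\mathbf p=(p_1,\dots,p_M)$ with $p_m\ge 0$, let $\mathbf W=\mathbf U\,\mathrm{diag}(\sqrt{p_1},\dots,\sqrt{p_M})$ and define the sum communication rate and the sensing rate $$\mathcal R_{\rm c}(\mathbf p)=\sum_{m=1}^M\log_2(1+p_m\rho_m),\qquad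 \mathcal R_{\rm s}(\mathbf p)=\frac NL\log_2\det\left(\mathbf I_M+L\,\mathbf W^{\mathsf H}\mathbf R\mathbf W\right).$$ For $\alpha\in[0,1]$ and a power budget $p>0$, let $\overline{\mathcal R}_{\rm c}^{\alpha}=\mathcal R_{\rm c}(\mathbf p^\star)$, where $\mathbf p^\star$ (which depends on $p$ and on the channel realization) is an optimal power allocation of the rate-profile problem $$\max_{\mathbf p,\mathcal R}\ \mathcal R\quad\text{s.t.}\quad \mathcal R_{\rm s}(\mathbf p)\ge\alpha\mathcal R,\quad \mathcal R_{\rm c}(\mathbf p)\ge(1-\alpha)\mathcal R,\quad \sum_{m=1}^M p_m\le p,\quad p_m\ge 0 .$$ Then for every $\alpha\in[0,1]$ and every target rate $\mathcal R_0>0$, as $p\to\infty$, $$\Pr\left(\overline{\mathcal R}_{\rm c}^{\alpha}<\mathcal R_0\right)=\mathcal O\left(p^{-M(K-M+1)}\right),$$ and the diversity order is exactly $M(K-M+1)$, whatever $\alpha$ is (in particular it is the same for $\alpha=1$, the sensing-centric design, and for $\alpha=0$, the communications-centric design): $$\lim_{p\to\infty}\frac{-\log\Pr\left(\overline{\mathcal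 R}_{\rm c}^{\alpha}<\mathcal R_0\right)}{\log p}=M(K-M+1).$$ -/

import Mathlib

open MeasureTheory ProbabilityTheory Filter Topology Asymptotics
open scoped ComplexOrder

/-- The standard circularly symmetric complex Gaussian law with mean zero and unit variance:
the real and imaginary parts are independent real Gaussians of variance `1 / 2`. -/
noncomputable def stdComplexGaussian : Measure ℂ :=
  ((gaussianReal 0 (1 / 2)).prod (gaussianReal 0 (1 / 2))).map
    (fun z : ℝ × ℝ => (⟨z.1, z.2⟩ : ℂ))

/-- Rayleigh fading: the entries of all the channel matrices `H m` (`K × M`, one for each of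
the `M` user terminals) are jointly independent standard complex Gaussians. -/
structure IsRayleighFading {Ω : Type*} [MeasurableSpace Ω] (μ : Measure Ω) {M K : ℕ}
    (H : Fin M → Ω → Matrix (Fin K) (Fin M) ℂ) : Prop where
  law : ∀ (m : Fin M) (k : Fin K) (j : Fin M),
    HasLaw (fun ω => H m ω k j) stdComplexGaussian μ
  indep : iIndepFun
    (fun (i : Fin M × Fin K × Fin M) (ω : Ω) => H i.1 ω i.2.1 i.2.2) μ

/-- The normalized zero-forcing equalizer `v = q / ‖q‖`, where `q` is the `m`-th column of
`A (Aᴴ A)⁻¹` and `A` is the effective channel of terminal `m`. -/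
noncomputable def zfEqualizer {M K : ℕ} (A : Matrix (Fin K) (Fin M) ℂ) (m : Fin M) :
    EuclideanSpace ℂ (Fin K) :=
  let q : EuclideanSpace ℂ (Fin K) :=
    WithLp.toLp 2 (fun k => (A * (A.conjTranspose * A)⁻¹) k m)
  ((‖q‖⁻¹ : ℝ) : ℂ) • q

/-- The gain `ρ_m = |v_mᴴ H_m p_m|²` of terminal `m`, for its channel matrix `Hm`, the matrix
`P` of normalized precoders (its `m`-th column being `p_m`), and the equalizer `v_m` computed
from the effective channel `Hm * P`. -/
noncomputable def channelGain {M K : ℕ} (Hm : Matrix (Fin K) (Fin M) ℂ)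
    (P : Matrix (Fin M) (Fin M) ℂ) (m : Fin M) : ℝ :=
  ‖∑ k, star (zfEqualizer (Hm * P) m k) * (Hm.mulVec (fun j => P j m)) k‖ ^ 2

/-- The sum communication rate `∑ m, log₂ (1 + γ_m)` with received SNR `γ_m = q_m ρ_m`, for
the channel matrices `H`, the precoders `P` and the power allocation `q`. -/
noncomputable def sumCommRate {M K : ℕ} (H : Fin M → Matrix (Fin K) (Fin M) ℂ)
    (P : Matrix (Fin M) (Fin M) ℂ) (q : Fin M → ℝ) : ℝ :=
  ∑ m, Real.logb 2 (1 + q m * channelGain (H m) P m)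

/-- The precoding matrix `W = P diag(√q₁, …, √q_M)`. -/
noncomputable def precodingMatrix {M : ℕ} (P : Matrix (Fin M) (Fin M) ℂ) (q : Fin M → ℝ) :
    Matrix (Fin M) (Fin M) ℂ :=
  P * Matrix.diagonal (fun m => ((Real.sqrt (q m) : ℝ) : ℂ))

/-- The sensing rate `(N / L) log₂ det (I + L Wᴴ R W)`. The determinant is a positive real
number when `R` is positive definite. -/
noncomputable def sensingRate {M : ℕ} (N L : ℕ) (R W : Matrix (Fin M) (Fin M) ℂ) : ℝ :=
  (N : ℝ) / (L : ℝ) *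
    Real.logb 2 ((1 + (L : ℂ) • (W.conjTranspose * R * W)).det).re

/-- The constraints of the rate-profile problem on the power allocation `q` and the value `r`:
the sensing rate is at least `α r`, the communication rate is at least `(1 - α) r`, the powers
are nonnegative and their sum is at most `p`. -/
structure RateProfileFeasible {M K : ℕ} (N L : ℕ) (R U : Matrix (Fin M) (Fin M) ℂ)
    (H : Fin M → Matrix (Fin K) (Fin M) ℂ) (α p : ℝ) (q : Fin M → ℝ) (r : ℝ) : Prop where
  sensing : α * r ≤ sensingRate N L R (precodingMatrix U q)
  comm : (1 - α) * r ≤ sumCommRate H U q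
  budget : ∑ m, q m ≤ p
  nonneg : ∀ m, 0 ≤ q m

/-- `q` is an optimal power allocation of the rate-profile problem: together with some `r` it
is feasible, and no feasible pair has a value larger than `r`. -/
def IsParetoPower {M K : ℕ} (N L : ℕ) (R U : Matrix (Fin M) (Fin M) ℂ)
    (H : Fin M → Matrix (Fin K) (Fin M) ℂ) (α p : ℝ) (q : Fin M → ℝ) : Prop :=
  ∃ r : ℝ, RateProfileFeasible N L R U H α p q r ∧
    ∀ (q' : Fin M → ℝ) (r' : ℝ), RateProfileFeasible N L R U H α p q' r' → r' ≤ r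

/-- The outage probability: the probability that the sum communication rate under the random
power allocation `q` is below the target `R₀`. -/
noncomputable def outageProb {Ω : Type*} [MeasurableSpace Ω] (μ : Measure Ω) {M K : ℕ}
    (H : Fin M → Ω → Matrix (Fin K) (Fin M) ℂ) (U : Matrix (Fin M) (Fin M) ℂ)
    (q : Ω → Fin M → ℝ) (R₀ : ℝ) : ℝ :=
  μ.real {ω | sumCommRate (fun m => H m ω) U (q ω) < R₀}

/-! ### The standard complex Gaussian law -/

/-! The probabilistic part rests on geometry: the zero-forcing vector `q` is biorthogonal to the
columns of the effective channel, so the gain equals `1 / ‖q‖ ^ 2`, the squared distance of the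
`m`-th column to the span of the others (`channelGain_lt_iff_of_det_ne_zero`). By unitary invariance
the columns of `H U` are again independent standard Gaussian vectors. Given the other `M - 1`
columns, the squared distance is generically the squared norm of `K - M + 1` independent standard
Gaussians, so it is below a small `t` with probability of order `t ^ (K - M + 1)`. The terminals are
independent, hence all `M` gains are below `t` with probability of order `t ^ (M * (K - M + 1))`
(`IsRayleighFading.exists_measureReal_bounds`).

The rest is deterministic: for large `p` the outage event lies between two events of the form "all
gains are below `const / p`". The budget caps every power by `p`, so small gains force outage
(`sumCommRate_lt_of_channelGain_lt`). Conversely (`exists_channelGain_lt_of_outage`), for `α < 1`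
the uniform allocation eventually meets the sensing constraint at value `R₀ / (1 - α)`, so by
optimality an outage of the optimal allocation is also one of the uniform allocation. For `α = 1`
the optimal allocation maximizes `∏ (1 + L q_m λ_m)`, which forces every power to be of order `p`.
Thus `α` affects constants only, never the exponent. -/

lemma measurable_complexMk : Measurable (fun z : ℝ × ℝ => (⟨z.1, z.2⟩ : ℂ)) :=
  Complex.measurableEquivRealProd.symm.measurable

instance isProbabilityMeasure_stdComplexGaussian :
    IsProbabilityMeasure stdComplexGaussian :=
  Measure.isProbabilityMeasure_map measurable_complexMk.aemeasurable

/-- The value depends on `w` only through its norm; this is the source of unitary invariance. -/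
lemma charFun_stdComplexGaussian (w : ℂ) :
    charFun stdComplexGaussian w = Complex.exp (-(‖w‖ ^ 2 / 4 : ℝ)) := by
  have hint : charFun stdComplexGaussian w =
      ∫ z : ℝ × ℝ, Complex.exp (w.re * z.1 * Complex.I) * Complex.exp (w.im * z.2 * Complex.I)
        ∂((gaussianReal 0 (1 / 2)).prod (gaussianReal 0 (1 / 2))) := by
    rw [charFun_apply, stdComplexGaussian,
      integral_map measurable_complexMk.aemeasurable
        (Continuous.aestronglyMeasurable (by fun_prop))]
    congr 1
    ext z
    rw [← Complex.exp_add, Complex.inner]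
    congr 1
    simp
    ring
  rw [hint, integral_prod_mul (fun x : ℝ => Complex.exp (w.re * x * Complex.I))
      (fun y : ℝ => Complex.exp (w.im * y * Complex.I)),
    ← charFun_apply_real, ← charFun_apply_real, charFun_gaussianReal, charFun_gaussianReal,
    ← Complex.exp_add, Complex.sq_norm, Complex.normSq_apply]
  congr 1
  push_cast
  ring

lemma charFun_pi_stdComplexGaussian {ι : Type*} [Fintype ι] (t : EuclideanSpace ℂ ι) :
    charFun ((Measure.pi fun _ : ι => stdComplexGaussian).map (WithLp.toLp 2)) t =
      Complex.exp (-(‖t‖ ^ 2 / 4 : ℝ)) := by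
  rw [charFun_pi]
  simp_rw [charFun_stdComplexGaussian]
  rw [← Complex.exp_sum, EuclideanSpace.norm_sq_eq]
  congr 1
  push_cast
  rw [Finset.sum_neg_distrib, Finset.sum_div]

/-- `charFun` pairs vectors by the real inner product, while a unitary map is controlled through the
complex one. -/
lemma real_inner_eq_re_inner_euclidean {ι : Type*} [Fintype ι] (x y : EuclideanSpace ℂ ι) :
    inner ℝ x y = (inner ℂ x y).re := by
  simp [PiLp.inner_apply, Complex.inner]

/-- A standard complex Gaussian vector is invariant under unitary maps. -/
lemma measurePreserving_pi_stdComplexGaussian {ι : Type*} [Fintype ι]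
    (f : EuclideanSpace ℂ ι ≃ₗᵢ[ℂ] EuclideanSpace ℂ ι) :
    MeasurePreserving (fun z : ι → ℂ => WithLp.ofLp (f (WithLp.toLp 2 z)))
      (Measure.pi fun _ : ι => stdComplexGaussian)
      (Measure.pi fun _ : ι => stdComplexGaussian) := by
  set ν := Measure.pi fun _ : ι => stdComplexGaussian
  have hto : Measurable (WithLp.toLp 2 : (ι → ℂ) → EuclideanSpace ℂ ι) := by fun_prop
  have hof : Measurable (WithLp.ofLp : EuclideanSpace ℂ ι → (ι → ℂ)) := by fun_prop
  have hf : Measurable f := f.continuous.measurable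
  have key : (ν.map (WithLp.toLp 2)).map f = ν.map (WithLp.toLp 2) := by
    have : IsProbabilityMeasure (ν.map (WithLp.toLp 2 : (ι → ℂ) → EuclideanSpace ℂ ι)) :=
      Measure.isProbabilityMeasure_map hto.aemeasurable
    have : IsProbabilityMeasure
        ((ν.map (WithLp.toLp 2 : (ι → ℂ) → EuclideanSpace ℂ ι)).map f) :=
      Measure.isProbabilityMeasure_map hf.aemeasurable
    refine Measure.ext_of_charFun (funext fun t => ?_)
    have h1 : charFun ((ν.map (WithLp.toLp 2)).map f) t =
        charFun (ν.map (WithLp.toLp 2)) (f.symm t) := by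
      rw [charFun_apply, charFun_apply, integral_map hf.aemeasurable
        (Continuous.aestronglyMeasurable (by fun_prop))]
      congr 1
      ext x
      rw [real_inner_eq_re_inner_euclidean, real_inner_eq_re_inner_euclidean,
        f.inner_map_eq_flip]
    rw [h1, charFun_pi_stdComplexGaussian, charFun_pi_stdComplexGaussian,
      LinearIsometryEquiv.norm_map]
  refine ⟨hof.comp (hf.comp hto), ?_⟩
  have : (fun z : ι → ℂ => WithLp.ofLp (f (WithLp.toLp 2 z))) =
      WithLp.ofLp ∘ (f ∘ WithLp.toLp 2) := rfl
  rw [this, ← Measure.map_map hof (hf.comp hto), ← Measure.map_map hf hto, key,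
    Measure.map_map hof hto]
  exact Measure.map_id

/-- Regrouping the coordinates of a product measure. -/
lemma measurePreserving_curry_equiv {τ ι κ E : Type*} [Fintype τ] [Fintype ι] [Fintype κ]
    [MeasurableSpace E] (ν : Measure E) [SigmaFinite ν] (e : ι × κ ≃ τ) :
    MeasurePreserving (fun (z : τ → E) i j => z (e (i, j)))
      (Measure.pi fun _ : τ => ν) (Measure.pi fun _ : ι => Measure.pi fun _ : κ => ν) := by
  have hm : Measurable (fun (z : τ → E) (i : ι) (j : κ) => z (e (i, j))) := by fun_prop
  set g : (ι → κ → E) → τ → E := fun y k => y (e.symm k).1 (e.symm k).2 with hg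
  have hgm : Measurable g := by fun_prop
  have key : (Measure.pi fun _ : τ => ν) =
      (Measure.pi fun _ : ι => Measure.pi fun _ : κ => ν).map g := by
    refine Measure.pi_eq fun s hs => ?_
    rw [Measure.map_apply hgm (MeasurableSet.univ_pi hs)]
    have : g ⁻¹' Set.univ.pi s = Set.univ.pi fun i => Set.univ.pi fun j => s (e (i, j)) := by
      ext y
      simp only [Set.mem_preimage, Set.mem_univ_pi, hg]
      refine ⟨fun h i j => by simpa using h (e (i, j)), fun h k => ?_⟩
      have := h (e.symm k).1 (e.symm k).2
      rwa [Prod.mk.eta, e.apply_symm_apply] at this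
    rw [this, Measure.pi_pi]
    simp_rw [Measure.pi_pi]
    rw [← Fintype.prod_prod_type' (fun i j => ν (s (e (i, j))))]
    exact Fintype.prod_equiv e _ _ fun x => rfl
  refine ⟨hm, ?_⟩
  rw [key, Measure.map_map hm hgm]
  have : (fun (z : τ → E) (i : ι) (j : κ) => z (e (i, j))) ∘ g = id := by
    ext y i j
    simp [hg]
  rw [this, Measure.map_id]

/-! ### Small balls -/

/-- The density is at most `1 / √π ≤ 1`. -/
lemma gaussianReal_half_Ioo_le (r : ℝ) :
    gaussianReal 0 (1 / 2) (Set.Ioo (-r) r) ≤ ENNReal.ofReal (2 * r) := by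
  rw [gaussianReal_apply 0 (by norm_num)]
  calc ∫⁻ x in Set.Ioo (-r) r, gaussianPDF 0 (1 / 2) x
      ≤ ∫⁻ _ in Set.Ioo (-r) r, 1 := by
        refine lintegral_mono fun x => ?_
        rw [gaussianPDF, ENNReal.ofReal_le_one, gaussianPDFReal]
        have h1 : (√(2 * Real.pi * ((1 / 2 : NNReal) : ℝ)))⁻¹ ≤ 1 := by
          refine inv_le_one_of_one_le₀ ?_
          rw [Real.one_le_sqrt]
          push_cast
          linarith [Real.pi_gt_three]
        have h2 : Real.exp (-(x - 0) ^ 2 / (2 * ((1 / 2 : NNReal) : ℝ))) ≤ 1 := by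
          rw [Real.exp_le_one_iff]
          push_cast
          nlinarith [sq_nonneg (x - 0)]
        exact mul_le_one₀ h1 (Real.exp_pos _).le h2
    _ = ENNReal.ofReal (2 * r) := by
        simp [Real.volume_Ioo, two_mul]

lemma le_gaussianReal_half_Ioo {r : ℝ} (hr0 : 0 ≤ r) (hr1 : r ≤ 1) :
    ENNReal.ofReal (r / 6) ≤ gaussianReal 0 (1 / 2) (Set.Ioo (-r) r) := by
  rw [gaussianReal_apply 0 (by norm_num)]
  calc ENNReal.ofReal (r / 6)
      -- On `(-1, 1)` the density `exp (-x ^ 2) / √π` is at least `(1 / 6) * (1 / 2) = 1 / 12`.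
      = ∫⁻ _ in Set.Ioo (-r) r, ENNReal.ofReal (1 / 12) := by
        rw [setLIntegral_const, Real.volume_Ioo, ← ENNReal.ofReal_mul (by norm_num)]
        congr 1
        ring
    _ ≤ ∫⁻ x in Set.Ioo (-r) r, gaussianPDF 0 (1 / 2) x := by
        refine setLIntegral_mono' measurableSet_Ioo fun x hx => ?_
        rw [gaussianPDF]
        refine ENNReal.ofReal_le_ofReal ?_
        rw [gaussianPDFReal]
        have h1 : (1 / 2 : ℝ) ≤ (√(2 * Real.pi * ((1 / 2 : NNReal) : ℝ)))⁻¹ := by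
          rw [one_div]
          refine inv_anti₀ (Real.sqrt_pos.2 (by push_cast; positivity)) ?_
          rw [Real.sqrt_le_left (by norm_num)]
          push_cast
          linarith [Real.pi_lt_four]
        have h2 : (1 / 6 : ℝ) ≤ Real.exp (-(x - 0) ^ 2 / (2 * ((1 / 2 : NNReal) : ℝ))) := by
          have hx2 : x ^ 2 ≤ 1 := by nlinarith [hx.1, hx.2]
          calc (1 / 6 : ℝ) ≤ (Real.exp 1)⁻¹ := by
                rw [one_div]
                exact inv_anti₀ (Real.exp_pos 1) (by linarith [Real.exp_one_lt_d9])
            _ = Real.exp (-1) := (Real.exp_neg 1).symm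
            _ ≤ _ := by
                refine Real.exp_le_exp.2 ?_
                push_cast
                nlinarith
        calc (1 / 12 : ℝ) = 1 / 2 * (1 / 6) := by norm_num
          _ ≤ _ := mul_le_mul h1 h2 (by norm_num) (by positivity)

lemma measurableSet_normSq_lt (t : ℝ) : MeasurableSet {z : ℂ | ‖z‖ ^ 2 < t} :=
  measurableSet_lt (by fun_prop) measurable_const

/-- The disc lies in the square of half-side `√t`, whose probability is a product. -/
lemma stdComplexGaussian_ball_le {t : ℝ} (ht : 0 ≤ t) :
    stdComplexGaussian {z : ℂ | ‖z‖ ^ 2 < t} ≤ ENNReal.ofReal (4 * t) := by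
  rw [stdComplexGaussian, Measure.map_apply measurable_complexMk (measurableSet_normSq_lt t)]
  calc _ ≤ ((gaussianReal 0 (1 / 2)).prod (gaussianReal 0 (1 / 2)))
        (Set.Ioo (-√t) (√t) ×ˢ Set.Ioo (-√t) (√t)) := by
        refine measure_mono fun z hz => ?_
        simp only [Set.mem_preimage, Set.mem_ofPred_eq, Complex.sq_norm,
          Complex.normSq_apply] at hz
        rw [Set.mem_prod, Set.mem_Ioo, Set.mem_Ioo, ← abs_lt, ← abs_lt]
        exact ⟨(Real.lt_sqrt (abs_nonneg _)).2 (by rw [sq_abs]; nlinarith),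
          (Real.lt_sqrt (abs_nonneg _)).2 (by rw [sq_abs]; nlinarith)⟩
    _ ≤ ENNReal.ofReal (2 * √t) * ENNReal.ofReal (2 * √t) := by
        rw [Measure.prod_prod]
        exact mul_le_mul' (gaussianReal_half_Ioo_le _) (gaussianReal_half_Ioo_le _)
    _ = ENNReal.ofReal (4 * t) := by
        rw [← ENNReal.ofReal_mul (by positivity)]
        congr 1
        nlinarith [Real.mul_self_sqrt ht]

/-- The disc contains the square of half-side `√(t / 2)`; `t / 72` is `(√(t / 2) / 6) ^ 2`. -/
lemma le_stdComplexGaussian_ball {t : ℝ} (ht : 0 ≤ t) (ht1 : t ≤ 1) :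
    ENNReal.ofReal (t / 72) ≤ stdComplexGaussian {z : ℂ | ‖z‖ ^ 2 < t} := by
  rw [stdComplexGaussian, Measure.map_apply measurable_complexMk (measurableSet_normSq_lt t)]
  have h2 : √(t / 2) ≤ 1 := by
    rw [Real.sqrt_le_one]
    linarith
  have hs : √(t / 2) * √(t / 2) = t / 2 := Real.mul_self_sqrt (by linarith)
  calc ENNReal.ofReal (t / 72)
      = ENNReal.ofReal (√(t / 2) / 6) * ENNReal.ofReal (√(t / 2) / 6) := by
        rw [← ENNReal.ofReal_mul (by positivity)]
        congr 1
        nlinarith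
    _ ≤ ((gaussianReal 0 (1 / 2)).prod (gaussianReal 0 (1 / 2)))
        (Set.Ioo (-√(t / 2)) (√(t / 2)) ×ˢ Set.Ioo (-√(t / 2)) (√(t / 2))) := by
        rw [Measure.prod_prod]
        exact mul_le_mul' (le_gaussianReal_half_Ioo (Real.sqrt_nonneg _) h2)
          (le_gaussianReal_half_Ioo (Real.sqrt_nonneg _) h2)
    _ ≤ _ := by
        refine measure_mono fun z hz => ?_
        rw [Set.mem_prod, Set.mem_Ioo, Set.mem_Ioo, ← abs_lt, ← abs_lt] at hz
        simp only [Set.mem_preimage, Set.mem_ofPred_eq, Complex.sq_norm, Complex.normSq_apply]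
        have h1 := mul_self_lt_mul_self (abs_nonneg _) hz.1
        have h2 := mul_self_lt_mul_self (abs_nonneg _) hz.2
        rw [abs_mul_abs_self] at h1 h2
        linarith

/-! ### The zero-forcing gain -/

/-- The gain depends on the channel and the precoders only through the effective channel. -/
lemma channelGain_eq_mul_one {M K : ℕ} (Hm : Matrix (Fin K) (Fin M) ℂ)
    (P : Matrix (Fin M) (Fin M) ℂ) (m : Fin M) :
    channelGain Hm P m = channelGain (Hm * P) 1 m := by
  have : (Hm * P).mulVec (fun j => (1 : Matrix (Fin M) (Fin M) ℂ) j m) =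
      Hm.mulVec (fun j => P j m) := by
    ext k
    simp [Matrix.mulVec, dotProduct, Matrix.mul_apply, Matrix.one_apply]
  unfold channelGain
  rw [this, Matrix.mul_one]

lemma channelGain_nonneg {M K : ℕ} (Hm : Matrix (Fin K) (Fin M) ℂ)
    (P : Matrix (Fin M) (Fin M) ℂ) (m : Fin M) : 0 ≤ channelGain Hm P m :=
  sq_nonneg _

/-- A convention: the inverse of a singular matrix is `0`, so the equalizer vanishes. Singular
channels therefore count as having gain below every `t > 0`. -/
lemma channelGain_eq_zero_of_det_eq_zero {M K : ℕ} {A : Matrix (Fin K) (Fin M) ℂ}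
    (hA : (A.conjTranspose * A).det = 0) (m : Fin M) : channelGain A 1 m = 0 := by
  have : (A.conjTranspose * A)⁻¹ = 0 := Matrix.nonsing_inv_apply_not_isUnit _ (by simp [hA])
  simp [channelGain, zfEqualizer, this]

/-- The gain of a nonsingular channel is below `t` if and only if the squared distance of the
`m`-th column to the span of the other columns is. -/
lemma channelGain_lt_iff_of_det_ne_zero {M K : ℕ} {A : Matrix (Fin K) (Fin M) ℂ}
    (hA : (A.conjTranspose * A).det ≠ 0) (m : Fin M) (t : ℝ) :
    channelGain A 1 m < t ↔ ∃ y : Fin M → ℂ, y m = 1 ∧ ∑ k, ‖A.mulVec y k‖ ^ 2 < t := by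
  set B := (A.conjTranspose * A)⁻¹ with hB
  set w : Fin M → ℂ := fun j => B j m with hw
  have hunit : IsUnit (A.conjTranspose * A).det := isUnit_iff_ne_zero.2 hA
  set q : EuclideanSpace ℂ (Fin K) := WithLp.toLp 2 (fun k => (A * B) k m) with hq
  have hqw : ∀ k, q k = A.mulVec w k := fun k => rfl
  -- `Aᴴ q` is the `m`-th basis vector: `q` is orthogonal to all columns but the `m`-th.
  have hAq : ∀ j, ∑ k, star (A k j) * q k = if j = m then 1 else 0 := by
    intro j
    have h1 : A.conjTranspose * (A * B) = 1 := by
      rw [← Matrix.mul_assoc, hB, Matrix.mul_nonsing_inv _ hunit]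
    have h2 := congrFun (congrFun h1 j) m
    rw [Matrix.mul_apply, Matrix.one_apply] at h2
    exact h2
  have hinner : ∀ y : Fin M → ℂ, ∑ k, star (q k) * A.mulVec y k = y m := by
    intro y
    calc ∑ k, star (q k) * A.mulVec y k
        = ∑ j, star (∑ k, star (A k j) * q k) * y j := by
          simp only [Matrix.mulVec, dotProduct, Finset.mul_sum, star_sum, star_mul', star_star,
            Finset.sum_mul]
          rw [Finset.sum_comm]
          exact Finset.sum_congr rfl fun j _ => Finset.sum_congr rfl fun k _ => by ring
      _ = y m := by
          simp_rw [hAq]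
          simp [apply_ite]
  have hnorm : ((‖q‖ ^ 2 : ℝ) : ℂ) = w m := by
    rw [← hinner w, EuclideanSpace.norm_sq_eq]
    push_cast
    refine Finset.sum_congr rfl fun k _ => ?_
    rw [← hqw, ← Complex.conj_mul']
    rfl
  have hq0 : q ≠ 0 := by
    intro h
    have := hAq m
    rw [h] at this
    simp at this
  have hqpos : 0 < ‖q‖ := norm_pos_iff.2 hq0
  have hgain : channelGain A 1 m = (‖q‖ ^ 2)⁻¹ := by
    have h1 : ∑ k, star (zfEqualizer (A * (1 : Matrix (Fin M) (Fin M) ℂ)) m k) *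
        (A.mulVec (fun j => (1 : Matrix (Fin M) (Fin M) ℂ) j m)) k = ((‖q‖⁻¹ : ℝ) : ℂ) := by
      have h2 := hinner (fun j => (1 : Matrix (Fin M) (Fin M) ℂ) j m)
      rw [Matrix.one_apply_eq] at h2
      calc _ = ∑ k, ((‖q‖⁻¹ : ℝ) : ℂ) *
            (star (q k) * A.mulVec (fun j => (1 : Matrix (Fin M) (Fin M) ℂ) j m) k) := by
            refine Finset.sum_congr rfl fun k _ => ?_
            have : zfEqualizer (A * (1 : Matrix (Fin M) (Fin M) ℂ)) m k = ((‖q‖⁻¹ : ℝ) : ℂ) * q k := by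
              rw [Matrix.mul_one]
              rfl
            rw [this, star_mul', mul_assoc]
            congr 1
            exact Complex.conj_ofReal _
        _ = _ := by rw [← Finset.mul_sum, h2, mul_one]
    unfold channelGain
    rw [h1, Complex.norm_real, Real.norm_eq_abs, sq_abs, inv_pow]
  rw [hgain]
  constructor
  · intro h
    have hwm : w m ≠ 0 := by
      rw [← hnorm]
      exact_mod_cast (pow_pos hqpos 2).ne'
    refine ⟨fun j => (w m)⁻¹ * w j, inv_mul_cancel₀ hwm, ?_⟩
    -- The normalized `w` attains the distance: its image is `q / ‖q‖ ^ 2`, of squared norm `1 / ‖q‖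
    -- ^ 2`.
    have h1 : ∀ k, A.mulVec (fun j => (w m)⁻¹ * w j) k = (w m)⁻¹ * q k := by
      intro k
      rw [hqw]
      simp only [Matrix.mulVec, dotProduct, Finset.mul_sum]
      exact Finset.sum_congr rfl fun j _ => by ring
    have h2 : ‖w m‖ = ‖q‖ ^ 2 := by
      rw [← hnorm, Complex.norm_real, Real.norm_of_nonneg (by positivity)]
    simp_rw [h1, norm_mul, mul_pow]
    rw [← Finset.mul_sum, ← EuclideanSpace.norm_sq_eq, norm_inv, h2]
    refine lt_of_eq_of_lt ?_ h
    field_simp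
  · rintro ⟨y, hy, hlt⟩
    set v : EuclideanSpace ℂ (Fin K) := WithLp.toLp 2 (A.mulVec y)
    have hqv : inner ℂ q v = 1 := by
      rw [← hy, ← hinner y, PiLp.inner_apply]
      refine Finset.sum_congr rfl fun k _ => ?_
      rw [RCLike.inner_apply, mul_comm]
      rfl
    -- Cauchy–Schwarz: `⟪q, A y⟫ = y m = 1` for every competitor `y`.
    have h1 : 1 ≤ ‖q‖ * ‖v‖ := by
      have := norm_inner_le_norm (𝕜 := ℂ) q v
      rwa [hqv, norm_one] at this
    have h2 : ‖v‖ ^ 2 < t := by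
      rw [EuclideanSpace.norm_sq_eq]
      exact hlt
    refine lt_of_le_of_lt ?_ h2
    rw [inv_le_iff_one_le_mul₀ (by positivity)]
    nlinarith [norm_nonneg v]

lemma exists_mulVec_eq_zero_of_gram_det_eq_zero {M K : ℕ} {A : Matrix (Fin K) (Fin M) ℂ}
    (hA : (A.conjTranspose * A).det = 0) : ∃ y : Fin M → ℂ, y ≠ 0 ∧ A.mulVec y = 0 := by
  obtain ⟨y, hy, h⟩ := Matrix.exists_mulVec_eq_zero_iff.2 hA
  exact ⟨y, hy, (Matrix.conjTranspose_mul_self_mulVec_eq_zero A y).1 h⟩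

lemma gram_det_eq_zero_of_mulVec_eq_zero {M K : ℕ} {A : Matrix (Fin K) (Fin M) ℂ}
    {y : Fin M → ℂ} (hy : y ≠ 0) (h : A.mulVec y = 0) : (A.conjTranspose * A).det = 0 :=
  Matrix.exists_mulVec_eq_zero_iff.1
    ⟨y, hy, (Matrix.conjTranspose_mul_self_mulVec_eq_zero A y).2 h⟩

/-- An orthonormal basis whose first vectors span the orthogonal complement of `V` and whose last
ones lie in `V`. -/
lemma exists_orthonormalBasis_adapted {K : ℕ} (V : Submodule ℂ (EuclideanSpace ℂ (Fin K))) :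
    ∃ e : OrthonormalBasis (Fin K) ℂ (EuclideanSpace ℂ (Fin K)), ∀ i : Fin K,
      ((i : ℕ) + Module.finrank ℂ V < K → e i ∈ Vᗮ) ∧
      (K ≤ (i : ℕ) + Module.finrank ℂ V → e i ∈ V) := by
  have hsum := V.finrank_add_finrank_orthogonal
  rw [finrank_euclideanSpace_fin] at hsum
  set d := Module.finrank ℂ Vᗮ with hd
  set r := Module.finrank ℂ V with hr
  let b := stdOrthonormalBasis ℂ Vᗮ
  let v : Fin K → EuclideanSpace ℂ (Fin K) := fun i => if h : (i : ℕ) < d then b ⟨i, h⟩ else 0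
  have hv : Orthonormal ℂ (({i : Fin K | (i : ℕ) < d} : Set (Fin K)).domRestrict v) := by
    have hb : Orthonormal ℂ (fun j : Fin d => (b j : EuclideanSpace ℂ (Fin K))) :=
      b.orthonormal.comp_linearIsometry Vᗮ.subtypeₗᵢ
    have h2 : ({i : Fin K | (i : ℕ) < d} : Set (Fin K)).domRestrict v =
        (fun j : Fin d => (b j : EuclideanSpace ℂ (Fin K))) ∘
          fun i : ({i : Fin K | (i : ℕ) < d} : Set (Fin K)) => ⟨i.1, i.2⟩ := by
      ext1 i
      have hi : (i.1 : ℕ) < d := i.2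
      simp [Set.domRestrict, v, hi]
    rw [h2]
    refine hb.comp _ fun i j hij => ?_
    simpa [Fin.ext_iff, Subtype.ext_iff] using hij
  obtain ⟨e, he⟩ := hv.exists_orthonormalBasis_extension_of_card_eq
    (by rw [finrank_euclideanSpace_fin, Fintype.card_fin])
  have he' : ∀ (i : Fin K) (h : (i : ℕ) < d), e i = b ⟨i, h⟩ := by
    intro i h
    rw [he i h]
    simp [v, h]
  refine ⟨e, fun i => ⟨fun h => ?_, fun h => ?_⟩⟩
  · rw [he' i (by omega)]
    exact (b _).2
  -- The remaining basis vectors are orthogonal to a basis of `Vᗮ`, hence lie in `Vᗮᗮ = V`.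
  · rw [← V.orthogonal_orthogonal, Submodule.mem_orthogonal]
    intro u hu
    have hrepr := b.sum_repr ⟨u, hu⟩
    have hu' : u = ∑ j, b.repr ⟨u, hu⟩ j • (b j : EuclideanSpace ℂ (Fin K)) := by
      have := congrArg (Subtype.val) hrepr
      simpa using this.symm
    rw [hu', sum_inner]
    refine Finset.sum_eq_zero fun j _ => ?_
    rw [inner_smul_left, ← he' ⟨j, by omega⟩ j.2,
      e.inner_eq_zero (by intro hc; have := congrArg Fin.val hc; simp at this; omega), mul_zero]

/-! ### Distance of a Gaussian vector to a fixed subspace -/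

lemma pi_stdComplexGaussian_first_coords {K : ℕ} (d : ℕ) (hd : d ≤ K) (S : Set ℂ) :
    (Measure.pi fun _ : Fin K => stdComplexGaussian)
      {c | ∀ i : Fin K, (i : ℕ) < d → c i ∈ S} = stdComplexGaussian S ^ d := by
  have h1 : {c : Fin K → ℂ | ∀ i : Fin K, (i : ℕ) < d → c i ∈ S} =
      Set.univ.pi fun i : Fin K => if (i : ℕ) < d then S else Set.univ := by
    ext c
    simp only [Set.mem_ofPred_eq, Set.mem_univ_pi]
    refine forall_congr' fun i => ?_
    split_ifs with h <;> simp [h]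
  rw [h1, Measure.pi_pi]
  have h2 : ∀ i : Fin K, stdComplexGaussian (if (i : ℕ) < d then S else Set.univ) =
      if (i : ℕ) < d then stdComplexGaussian S else 1 := by
    intro i
    split_ifs <;> simp
  simp_rw [h2]
  rw [Finset.prod_ite, Finset.prod_const, Finset.prod_const_one, mul_one]
  congr 1
  rw [Fin.card_filter_val_lt, min_eq_right hd]

lemma measurableSet_first_coords {K : ℕ} (d : ℕ) (t : ℝ) :
    MeasurableSet {c : Fin K → ℂ | ∀ i : Fin K, (i : ℕ) < d → c i ∈ {z : ℂ | ‖z‖ ^ 2 < t}} := by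
  simp only [Set.ofPred_forall]
  exact MeasurableSet.iInter fun i => MeasurableSet.iInter fun _ =>
    measurable_pi_apply i (measurableSet_normSq_lt t)

/-- The vectors at squared distance less than `t` from the span of the family `b`. -/
def nearSpan {K n : ℕ} (b : Fin n → Fin K → ℂ) (t : ℝ) : Set (Fin K → ℂ) :=
  {a | ∃ x : Fin n → ℂ, ∑ k, ‖a k + ∑ j, x j * b j k‖ ^ 2 < t}

/-- In an orthonormal basis adapted to the span, the coordinates stay independent Gaussians. Adding
an element of the span leaves the first `K - n` unchanged, and each is at most the distance in
modulus. A smaller span only leaves more such coordinates. -/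
lemma measure_nearSpan_le {K n : ℕ} (hn : n ≤ K) (b : Fin n → Fin K → ℂ) (t : ℝ) :
    (Measure.pi fun _ : Fin K => stdComplexGaussian) (nearSpan b t) ≤
      stdComplexGaussian {z : ℂ | ‖z‖ ^ 2 < t} ^ (K - n) := by
  set V : Submodule ℂ (EuclideanSpace ℂ (Fin K)) := Submodule.span ℂ
    (Set.range fun j => (WithLp.toLp 2 (b j) : EuclideanSpace ℂ (Fin K))) with hV
  have hr : Module.finrank ℂ V ≤ n := by
    exact (finrank_range_le_card (R := ℂ)
      (fun j => (WithLp.toLp 2 (b j) : EuclideanSpace ℂ (Fin K)))).trans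
      (Fintype.card_fin n).le
  obtain ⟨e, he⟩ := exists_orthonormalBasis_adapted V
  have hpres := measurePreserving_pi_stdComplexGaussian e.repr
  rw [← pi_stdComplexGaussian_first_coords (K - n) (Nat.sub_le K n),
    ← hpres.measure_preimage (measurableSet_first_coords _ t).nullMeasurableSet]
  refine measure_mono ?_
  rintro a ⟨x, hx⟩ i hi
  set u : EuclideanSpace ℂ (Fin K) := WithLp.toLp 2 a +
    ∑ j, x j • (WithLp.toLp 2 (b j) : EuclideanSpace ℂ (Fin K)) with hu
  have hperp : inner ℂ (e i) (∑ j, x j • (WithLp.toLp 2 (b j) : EuclideanSpace ℂ (Fin K))) = 0 := by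
    refine Submodule.inner_left_of_mem_orthogonal (K := V) ?_ ((he i).1 (by omega))
    exact Submodule.sum_mem _ fun j _ => Submodule.smul_mem _ _ (Submodule.subset_span ⟨j, rfl⟩)
  have h1 : inner ℂ (e i) (WithLp.toLp 2 a) = inner ℂ (e i) u := by
    rw [hu, inner_add_right, hperp, add_zero]
  have h2 : ‖u‖ ^ 2 < t := by
    rw [EuclideanSpace.norm_sq_eq]
    refine lt_of_eq_of_lt (Finset.sum_congr rfl fun k _ => ?_) hx
    simp [hu]
  have h3 : ‖inner ℂ (e i) u‖ ≤ ‖u‖ := by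
    simpa using norm_inner_le_norm (𝕜 := ℂ) (e i) u
  change ‖e.repr (WithLp.toLp 2 a) i‖ ^ 2 < t
  rw [e.repr_apply_apply, h1]
  exact lt_of_le_of_lt (pow_le_pow_left₀ (norm_nonneg _) h3 2) h2

/-- Independence makes the complement exactly `K - n` dimensional, so the distance involves only `K
- n` coordinates. Squares below `t / (K + 1)` then sum to less than `t`. -/
lemma le_measure_nearSpan {K n : ℕ} {b : Fin n → Fin K → ℂ}
    (hb : LinearIndependent ℂ b) {t : ℝ} (ht : 0 < t) :
    stdComplexGaussian {z : ℂ | ‖z‖ ^ 2 < t / (K + 1)} ^ (K - n) ≤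
      (Measure.pi fun _ : Fin K => stdComplexGaussian) (nearSpan b t) := by
  set V : Submodule ℂ (EuclideanSpace ℂ (Fin K)) := Submodule.span ℂ
    (Set.range fun j => (WithLp.toLp 2 (b j) : EuclideanSpace ℂ (Fin K))) with hV
  have hb' : LinearIndependent ℂ
      (fun j => (WithLp.toLp 2 (b j) : EuclideanSpace ℂ (Fin K))) :=
    hb.map' (WithLp.linearEquiv 2 ℂ (Fin K → ℂ)).symm.toLinearMap (LinearEquiv.ker _)
  have hr : Module.finrank ℂ V = n := by
    rw [hV, finrank_span_eq_card hb', Fintype.card_fin]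
  obtain ⟨e, he⟩ := exists_orthonormalBasis_adapted V
  rw [hr] at he
  have hpres := measurePreserving_pi_stdComplexGaussian e.repr
  rw [← pi_stdComplexGaussian_first_coords (K - n) (Nat.sub_le K n),
    ← hpres.measure_preimage (measurableSet_first_coords _ _).nullMeasurableSet]
  refine measure_mono fun a ha => ?_
  set s : Finset (Fin K) := Finset.univ.filter fun i => (i : ℕ) < K - n with hs
  set a' : EuclideanSpace ℂ (Fin K) := WithLp.toLp 2 a with ha'
  -- The combination sought cancels the component of `a` in `V`.
  have hmem : -∑ i ∈ sᶜ, e.repr a' i • e i ∈ V := by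
    refine Submodule.neg_mem _ (Submodule.sum_mem _ fun i hi => Submodule.smul_mem _ _ ?_)
    have : ¬ (i : ℕ) < K - n := by simpa [hs] using hi
    exact (he i).2 (by omega)
  obtain ⟨x, hx⟩ := (Submodule.mem_span_range_iff_exists_fun ℂ).1 hmem
  refine ⟨x, ?_⟩
  have h1 : a' + ∑ j, x j • (WithLp.toLp 2 (b j) : EuclideanSpace ℂ (Fin K)) =
      ∑ i ∈ s, e.repr a' i • e i := by
    rw [hx]
    nth_rewrite 1 [← e.sum_repr a']
    rw [← Finset.sum_add_sum_compl s, add_neg_cancel_right]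
  have h2 : ∑ k, ‖a k + ∑ j, x j * b j k‖ ^ 2 = ‖∑ i ∈ s, e.repr a' i • e i‖ ^ 2 := by
    rw [← h1, EuclideanSpace.norm_sq_eq]
    refine Finset.sum_congr rfl fun k _ => ?_
    simp [ha']
  have h3 : ‖∑ i ∈ s, e.repr a' i • e i‖ ^ 2 = ∑ i ∈ s, ‖e.repr a' i‖ ^ 2 := by
    have := e.orthonormal.inner_sum (fun i => e.repr a' i) (fun i => e.repr a' i) s
    rw [inner_self_eq_norm_sq_to_K] at this
    have h4 : ∀ i, (starRingEnd ℂ) (e.repr a' i) * e.repr a' i = ((‖e.repr a' i‖ ^ 2 : ℝ) : ℂ) := by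
      intro i
      rw [Complex.conj_mul']
      push_cast
      rfl
    simp_rw [h4] at this
    refine Complex.ofReal_injective ?_
    rw [Complex.ofReal_pow, Complex.ofReal_sum]
    exact this
  have hK : (0 : ℝ) < K + 1 := by positivity
  rw [h2, h3]
  calc ∑ i ∈ s, ‖e.repr a' i‖ ^ 2 ≤ ∑ i ∈ s, t / (K + 1) :=
        Finset.sum_le_sum fun i hi => (ha i (by simpa [hs] using hi)).le
    _ = s.card * (t / (K + 1)) := by rw [Finset.sum_const, nsmul_eq_mul]
    _ ≤ K * (t / (K + 1)) := by
        refine mul_le_mul_of_nonneg_right ?_ (by positivity)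
        exact_mod_cast (Finset.card_le_univ s).trans (by simp)
    _ < t := by
        rw [mul_div_assoc', div_lt_iff₀ hK]
        nlinarith

/-! ### The law of the zero-forcing gain near zero -/

/-- The families of columns such that the `m`-th one is at squared distance less than `t` from
the span of the others. -/
def nearColumns {M K : ℕ} (m : Fin M) (t : ℝ) : Set (Fin M → Fin K → ℂ) :=
  {G | ∃ y : Fin M → ℂ, y m = 1 ∧
    ∑ k, ‖(Matrix.of fun k j => G j k : Matrix (Fin K) (Fin M) ℂ).mulVec y k‖ ^ 2 < t}

/-- The families of linearly dependent columns. -/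
def dependentColumns (M K : ℕ) : Set (Fin M → Fin K → ℂ) :=
  {G | ((Matrix.of fun k j => G j k : Matrix (Fin K) (Fin M) ℂ).conjTranspose *
    (Matrix.of fun k j => G j k : Matrix (Fin K) (Fin M) ℂ)).det = 0}

/-- The uncountable union over `y` is harmless because each member is open. -/
lemma measurableSet_nearColumns {M K : ℕ} (m : Fin M) (t : ℝ) :
    MeasurableSet (nearColumns (K := K) m t) := by
  refine IsOpen.measurableSet ?_
  have : nearColumns (K := K) m t = ⋃ (y : Fin M → ℂ) (_ : y m = 1),
      {G | ∑ k, ‖∑ j, G j k * y j‖ ^ 2 < t} := by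
    ext G
    simp [nearColumns, Matrix.mulVec, dotProduct]
  rw [this]
  exact isOpen_iUnion fun y => isOpen_iUnion fun _ =>
    isOpen_lt (by fun_prop) continuous_const

lemma measurableSet_dependentColumns (M K : ℕ) : MeasurableSet (dependentColumns M K) := by
  refine IsClosed.measurableSet (isClosed_eq ?_ continuous_const)
  refine Continuous.matrix_det ?_
  have : Continuous fun G : Fin M → Fin K → ℂ =>
      (Matrix.of fun k j => G j k : Matrix (Fin K) (Fin M) ℂ) :=
    continuous_matrix fun k j => by simp only [Matrix.of_apply]; fun_prop
  exact this.matrix_conjTranspose.matrix_mul this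

lemma setOf_channelGain_lt {M K : ℕ} (m : Fin M) {t : ℝ} (ht : 0 < t) :
    {G : Fin M → Fin K → ℂ | channelGain (Matrix.of fun k j => G j k) 1 m < t} =
      nearColumns m t ∪ (dependentColumns M K) := by
  ext G
  simp only [Set.mem_union, Set.mem_ofPred_eq, nearColumns, dependentColumns]
  by_cases h : ((Matrix.of fun k j => G j k : Matrix (Fin K) (Fin M) ℂ).conjTranspose *
    (Matrix.of fun k j => G j k : Matrix (Fin K) (Fin M) ℂ)).det = 0
  · simp only [h, or_true, iff_true]
    rw [channelGain_eq_zero_of_det_eq_zero h]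
    exact ht
  · simp only [h, or_false]
    exact channelGain_lt_iff_of_det_ne_zero h m t

/-- A column with nonzero coefficient in a linear relation is at distance zero from the others. A
union bound thus controls degenerate channels, with no separate proof that they are negligible. -/
lemma dependentColumns_subset {M K : ℕ} {t : ℝ} (ht : 0 < t) :
    dependentColumns M K ⊆ ⋃ m, nearColumns m t := by
  intro G hG
  obtain ⟨y, hy, h0⟩ := exists_mulVec_eq_zero_of_gram_det_eq_zero hG
  obtain ⟨m, hm⟩ := Function.ne_iff.1 hy
  rw [Pi.zero_apply] at hm
  refine Set.mem_iUnion.2 ⟨m, (y m)⁻¹ • y, by simp [hm], ?_⟩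
  rw [Matrix.mulVec_smul, h0]
  simpa using ht

lemma mulVec_columns_succAbove {n K : ℕ} (m : Fin (n + 1)) (G : Fin (n + 1) → Fin K → ℂ)
    (y : Fin (n + 1) → ℂ) (k : Fin K) :
    (Matrix.of fun k j => G j k : Matrix (Fin K) (Fin (n + 1)) ℂ).mulVec y k =
      G m k * y m + ∑ j, y (m.succAbove j) * G (m.succAbove j) k := by
  simp only [Matrix.mulVec, dotProduct, Matrix.of_apply]
  rw [Fin.sum_univ_succAbove _ m]
  simp_rw [mul_comm]

/-- Fubini: conditioning on all columns but the `m`-th. -/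
lemma pi_columns_apply {n K : ℕ} (m : Fin (n + 1)) {S : Set (Fin (n + 1) → Fin K → ℂ)}
    (hS : MeasurableSet S) :
    (Measure.pi fun _ : Fin (n + 1) => Measure.pi fun _ : Fin K => stdComplexGaussian) S =
      ∫⁻ b, (Measure.pi fun _ : Fin K => stdComplexGaussian) {a | m.insertNth a b ∈ S}
        ∂(Measure.pi fun _ : Fin n => Measure.pi fun _ : Fin K => stdComplexGaussian) := by
  have hpres := (measurePreserving_piFinSuccAbove
    (fun _ : Fin (n + 1) => Measure.pi fun _ : Fin K => stdComplexGaussian) m).symm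
  rw [← hpres.measure_preimage hS.nullMeasurableSet,
    Measure.prod_apply_symm (hpres.measurable hS)]
  rfl

lemma measure_nearColumns_le {n K : ℕ} (hn : n + 1 ≤ K) (m : Fin (n + 1)) (t : ℝ) :
    (Measure.pi fun _ : Fin (n + 1) => Measure.pi fun _ : Fin K => stdComplexGaussian)
      (nearColumns m t) ≤ stdComplexGaussian {z : ℂ | ‖z‖ ^ 2 < t} ^ (K - n) := by
  rw [pi_columns_apply m (measurableSet_nearColumns m t)]
  calc _ ≤ ∫⁻ _, stdComplexGaussian {z : ℂ | ‖z‖ ^ 2 < t} ^ (K - n)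
        ∂(Measure.pi fun _ : Fin n => Measure.pi fun _ : Fin K => stdComplexGaussian) := by
        refine lintegral_mono fun b => ?_
        refine le_trans (measure_mono ?_) (measure_nearSpan_le (by omega) b t)
        rintro a ⟨y, hy, hlt⟩
        refine ⟨fun j => y (m.succAbove j), ?_⟩
        simpa only [mulVec_columns_succAbove m, hy, mul_one, Fin.insertNth_apply_same,
          Fin.insertNth_apply_succAbove] using hlt
    _ = _ := by simp

/-- When the other columns `b` are dependent, the section of the union is the whole space, so the
conditional lower bound holds for every `b`. -/
lemma le_measure_nearColumns_union {n K : ℕ} (m : Fin (n + 1)) {t : ℝ} (ht : 0 < t) :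
    stdComplexGaussian {z : ℂ | ‖z‖ ^ 2 < t / (K + 1)} ^ (K - n) ≤
    (Measure.pi fun _ : Fin (n + 1) => Measure.pi fun _ : Fin K => stdComplexGaussian)
      (nearColumns m t ∪ dependentColumns (n + 1) K) := by
  rw [pi_columns_apply m
    ((measurableSet_nearColumns m t).union (measurableSet_dependentColumns _ _))]
  calc _ = ∫⁻ _, stdComplexGaussian {z : ℂ | ‖z‖ ^ 2 < t / (K + 1)} ^ (K - n)
        ∂(Measure.pi fun _ : Fin n => Measure.pi fun _ : Fin K => stdComplexGaussian) := by simp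
    _ ≤ _ := by
        refine lintegral_mono fun b => ?_
        by_cases hb : LinearIndependent ℂ b
        · refine le_trans (le_measure_nearSpan hb ht) (measure_mono ?_)
          rintro a ⟨x, hx⟩
          refine Or.inl ⟨m.insertNth (1 : ℂ) x, Fin.insertNth_apply_same _ _ _, ?_⟩
          simpa only [mulVec_columns_succAbove m, mul_one, Fin.insertNth_apply_same,
            Fin.insertNth_apply_succAbove] using hx
        · have huniv : {a | m.insertNth a b ∈ nearColumns m t ∪ dependentColumns (n + 1) K} =
              Set.univ := by
            refine Set.eq_univ_of_forall fun a => Or.inr ?_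
            obtain ⟨x, hx, j, hj⟩ := Fintype.not_linearIndependent_iff.1 hb
            refine gram_det_eq_zero_of_mulVec_eq_zero (y := m.insertNth (0 : ℂ) x) ?_ ?_
            · intro h
              have := congrFun h (m.succAbove j)
              rw [Fin.insertNth_apply_succAbove] at this
              exact hj this
            · ext k
              rw [mulVec_columns_succAbove m]
              simpa using congrFun hx k
          rw [huniv, measure_univ]
          exact pow_le_one' prob_le_one _

/-- Two-sided bounds for the small-ball probabilities of the gain, the columns of the effective
channel being independent standard complex Gaussian vectors. -/
lemma measure_channelGain_lt_le {n K : ℕ} (hn : n + 1 ≤ K) (m : Fin (n + 1)) {t : ℝ}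
    (ht : 0 < t) :
    (Measure.pi fun _ : Fin (n + 1) => Measure.pi fun _ : Fin K => stdComplexGaussian)
      {G | channelGain (Matrix.of fun k j => G j k) 1 m < t} ≤
      ENNReal.ofReal ((n + 2) * (4 * t) ^ (K - n)) := by
  have hball : ∀ j : Fin (n + 1),
      (Measure.pi fun _ : Fin (n + 1) => Measure.pi fun _ : Fin K => stdComplexGaussian)
      (nearColumns j t) ≤ ENNReal.ofReal ((4 * t) ^ (K - n)) := by
    intro j
    rw [ENNReal.ofReal_pow (by positivity)]
    exact (measure_nearColumns_le hn j t).trans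
      (pow_le_pow_left' (stdComplexGaussian_ball_le ht.le) _)
  rw [setOf_channelGain_lt m ht]
  calc _ ≤ (Measure.pi fun _ : Fin (n + 1) => Measure.pi fun _ : Fin K => stdComplexGaussian)
          (nearColumns m t ∪ ⋃ j, nearColumns j t) :=
        measure_mono (Set.union_subset_union_right _ (dependentColumns_subset ht))
    -- The factor `n + 2` counts the `m`-th event once and the `n + 1` events covering the dependent
    -- families.
    _ ≤ ENNReal.ofReal ((4 * t) ^ (K - n)) +
          ∑ _j : Fin (n + 1), ENNReal.ofReal ((4 * t) ^ (K - n)) := by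
        refine (measure_union_le _ _).trans (add_le_add (hball m) ?_)
        exact (measure_iUnion_fintype_le _ _).trans (Finset.sum_le_sum fun j _ => hball j)
    _ = _ := by
        rw [← ENNReal.ofReal_sum_of_nonneg (fun _ _ => by positivity),
          ← ENNReal.ofReal_add (by positivity) (by positivity)]
        congr 1
        simp
        ring

lemma le_measure_channelGain_lt {n K : ℕ} (m : Fin (n + 1)) {t : ℝ} (ht : 0 < t) (ht1 : t ≤ 1) :
    ENNReal.ofReal ((t / (72 * (K + 1))) ^ (K - n)) ≤
    (Measure.pi fun _ : Fin (n + 1) => Measure.pi fun _ : Fin K => stdComplexGaussian)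
      {G | channelGain (Matrix.of fun k j => G j k) 1 m < t} := by
  rw [setOf_channelGain_lt m ht]
  refine le_trans ?_ (le_measure_nearColumns_union m ht)
  rw [ENNReal.ofReal_pow (by positivity)]
  refine pow_le_pow_left' (le_trans (ENNReal.ofReal_le_ofReal (le_of_eq ?_))
    (le_stdComplexGaussian_ball (t := t / (K + 1)) (by positivity) ?_)) _
  · field_simp
  · rw [div_le_one (by positivity)]
    have : (0 : ℝ) ≤ K := by positivity
    linarith

/-! ### Rates of a power allocation -/

/-- `Wᴴ R W` is diagonal with entries `q m * eig m`, because the precoders are eigenvectors of `R`.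
-/
lemma sensingRate_precodingMatrix {M : ℕ} (N L : ℕ) {R U : Matrix (Fin M) (Fin M) ℂ}
    {eig : Fin M → ℝ} (hU : U ∈ Matrix.unitaryGroup (Fin M) ℂ)
    (hRU : R = U * Matrix.diagonal (fun m => (eig m : ℂ)) * U.conjTranspose)
    {q : Fin M → ℝ} (hq : ∀ m, 0 ≤ q m) :
    sensingRate N L R (precodingMatrix U q) =
      (N : ℝ) / L * Real.logb 2 (∏ m, (1 + L * (q m * eig m))) := by
  have hUU : U.conjTranspose * U = 1 := Matrix.mem_unitaryGroup_iff'.1 hU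
  set D := Matrix.diagonal (fun m => ((Real.sqrt (q m) : ℝ) : ℂ)) with hD
  set E := Matrix.diagonal (fun m => (eig m : ℂ)) with hE
  have h1 : (U * D).conjTranspose * R * (U * D) =
      Matrix.diagonal fun m => ((q m * eig m : ℝ) : ℂ) := by
    calc (U * D).conjTranspose * R * (U * D)
        = D.conjTranspose * (U.conjTranspose * U) * E * (U.conjTranspose * U) * D := by
          rw [hRU, Matrix.conjTranspose_mul]
          simp only [Matrix.mul_assoc]
      _ = Matrix.diagonal fun m => ((q m * eig m : ℝ) : ℂ) := by
          rw [hUU, Matrix.mul_one, Matrix.mul_one, hD, hE, Matrix.diagonal_conjTranspose,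
            Matrix.diagonal_mul_diagonal, Matrix.diagonal_mul_diagonal]
          congr 1
          ext m
          rw [Pi.star_apply]
          have : star ((√(q m) : ℝ) : ℂ) = ((√(q m) : ℝ) : ℂ) := Complex.conj_ofReal _
          rw [this, ← Complex.ofReal_mul, ← Complex.ofReal_mul]
          congr 1
          rw [mul_right_comm, Real.mul_self_sqrt (hq m)]
  have h2 : 1 + (L : ℂ) • (Matrix.diagonal fun m => ((q m * eig m : ℝ) : ℂ)) =
      Matrix.diagonal fun m => ((1 + L * (q m * eig m) : ℝ) : ℂ) := by
    rw [← Matrix.diagonal_one, ← Matrix.diagonal_smul, Matrix.diagonal_add]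
    congr 1
    ext m
    simp
  rw [sensingRate, precodingMatrix, h1, h2, Matrix.det_diagonal, ← Complex.ofReal_prod,
    Complex.ofReal_re]

lemma eigenvalues_pos_of_posDef {M : ℕ} {R U : Matrix (Fin M) (Fin M) ℂ}
    {eig : Fin M → ℝ} (hR : R.PosDef) (hU : U ∈ Matrix.unitaryGroup (Fin M) ℂ)
    (hRU : R = U * Matrix.diagonal (fun m => (eig m : ℂ)) * U.conjTranspose) (m : Fin M) :
    0 < eig m := by
  have hunit : IsUnit U := IsUnit.of_mul_eq_one (star U) (Matrix.mem_unitaryGroup_iff.1 hU)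
  rw [hRU] at hR
  have := (Matrix.IsUnit.posDef_star_right_conjugate_iff hunit).1 hR
  have := Matrix.posDef_diagonal_iff.1 this m
  exact_mod_cast this

lemma logb_term_nonneg {x : ℝ} (hx : 0 ≤ x) : 0 ≤ Real.logb 2 (1 + x) :=
  Real.logb_nonneg one_lt_two (by linarith)

lemma sumCommRate_nonneg {M K : ℕ} (H : Fin M → Matrix (Fin K) (Fin M) ℂ)
    (P : Matrix (Fin M) (Fin M) ℂ) {q : Fin M → ℝ} (hq : ∀ m, 0 ≤ q m) :
    0 ≤ sumCommRate H P q :=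
  Finset.sum_nonneg fun m _ => logb_term_nonneg (mul_nonneg (hq m) (channelGain_nonneg _ _ _))

/-- If the sum rate is below `R₀`, then so is each summand, and all gains are small. -/
lemma channelGain_lt_of_sumCommRate_lt {M K : ℕ} {H : Fin M → Matrix (Fin K) (Fin M) ℂ}
    {P : Matrix (Fin M) (Fin M) ℂ} {q : Fin M → ℝ} {R₀ s : ℝ} (hs : 0 < s)
    (hq : ∀ m, s ≤ q m) (h : sumCommRate H P q < R₀) (m : Fin M) :
    channelGain (H m) P m < 2 ^ R₀ / s := by
  have hg := channelGain_nonneg (H m) P m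
  have hnn : ∀ j, 0 ≤ q j * channelGain (H j) P j := fun j =>
    mul_nonneg (hs.le.trans (hq j)) (channelGain_nonneg _ _ _)
  have h1 : Real.logb 2 (1 + q m * channelGain (H m) P m) < R₀ :=
    (Finset.single_le_sum (f := fun j => Real.logb 2 (1 + q j * channelGain (H j) P j))
      (fun j _ => logb_term_nonneg (hnn j)) (Finset.mem_univ m)).trans_lt h
  rw [Real.logb_lt_iff_lt_rpow one_lt_two (by linarith [hnn m])] at h1
  rw [lt_div_iff₀ hs]
  nlinarith [hq m]

/-- If all gains are small, then any allocation within the budget is in outage. -/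
lemma sumCommRate_lt_of_channelGain_lt {M K : ℕ} (hM : 0 < M)
    {H : Fin M → Matrix (Fin K) (Fin M) ℂ} {P : Matrix (Fin M) (Fin M) ℂ} {q : Fin M → ℝ}
    {R₀ p : ℝ} (hp : 0 < p) (hq : ∀ m, 0 ≤ q m) (hbudget : ∑ m, q m ≤ p)
    (h : ∀ m, channelGain (H m) P m < (2 ^ (R₀ / M) - 1) / p) :
    sumCommRate H P q < R₀ := by
  have hM' : (0 : ℝ) < M := by exact_mod_cast hM
  have hne : (Finset.univ : Finset (Fin M)).Nonempty := ⟨⟨0, hM⟩, Finset.mem_univ _⟩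
  calc sumCommRate H P q < ∑ _m : Fin M, R₀ / M := by
        refine Finset.sum_lt_sum_of_nonempty hne fun m _ => ?_
        have hg := channelGain_nonneg (H m) P m
        have hqm : q m ≤ p :=
          (Finset.single_le_sum (fun j _ => hq j) (Finset.mem_univ m)).trans hbudget
        have hgm := h m
        rw [lt_div_iff₀ hp] at hgm
        rw [Real.logb_lt_iff_lt_rpow one_lt_two
          (by linarith [mul_nonneg (hq m) hg])]
        nlinarith
    _ = R₀ := by
        rw [Finset.sum_const, Finset.card_univ, Fintype.card_fin, nsmul_eq_mul]
        field_simp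

/-! ### Outage under a Pareto optimal allocation -/

/-- If the sensing rate of the uniform allocation is not binding, then a Pareto optimal allocation
that is not sensing-centric is in outage only if the uniform one is. -/
lemma IsParetoPower.sumCommRate_uniform_lt {M K : ℕ} {N L : ℕ} (hM : 0 < M)
    {R U : Matrix (Fin M) (Fin M) ℂ} {H : Fin M → Matrix (Fin K) (Fin M) ℂ} {α p R₀ : ℝ}
    {q : Fin M → ℝ} (hα1 : α < 1) (hp : 0 < p)
    (hsens : α * (R₀ / (1 - α)) ≤
      sensingRate N L R (precodingMatrix U fun _ => p / M))
    (hq : IsParetoPower N L R U H α p q) (hout : sumCommRate H U q < R₀) :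
    sumCommRate H U (fun _ => p / M) < R₀ := by
  have hM' : (0 : ℝ) < M := by exact_mod_cast hM
  obtain ⟨r, hfeas, hopt⟩ := hq
  have h1α : 0 < 1 - α := by linarith
  by_contra! hge
  -- If the uniform allocation were not in outage, it would be feasible with value `R₀ / (1 - α)`;
  -- optimality would then give `q` a rate of at least `R₀`.
  have hr : R₀ / (1 - α) ≤ r := by
    refine hopt (fun _ => p / M) _ ⟨hsens, ?_, ?_, fun _ => by positivity⟩
    · rw [mul_div_cancel₀ _ h1α.ne']
      exact hge
    · rw [Finset.sum_const, Finset.card_univ, Fintype.card_fin, nsmul_eq_mul,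
        mul_div_cancel₀ _ hM'.ne']
  rw [div_le_iff₀ h1α] at hr
  linarith [hfeas.comm]

/-- The sensing-centric allocation gives each terminal a fixed fraction of the budget. -/
lemma IsParetoPower.le_power_of_sensing {M K : ℕ} {N L : ℕ} (hM : 0 < M) (hN : 0 < N)
    (hL : 0 < L) {R U : Matrix (Fin M) (Fin M) ℂ} {eig : Fin M → ℝ} (heig : ∀ m, 0 < eig m)
    (hU : U ∈ Matrix.unitaryGroup (Fin M) ℂ)
    (hRU : R = U * Matrix.diagonal (fun m => (eig m : ℂ)) * U.conjTranspose)
    {H : Fin M → Matrix (Fin K) (Fin M) ℂ} {p : ℝ} {q : Fin M → ℝ} (hp : 0 < p)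
    (hq : IsParetoPower N L R U H 1 p q) (m : Fin M) :
    p / M ^ M - 1 / (L * eig m) ≤ q m := by
  have hM' : (0 : ℝ) < M := by exact_mod_cast hM
  have hM1 : (1 : ℝ) ≤ M := by exact_mod_cast hM
  have hL' : (0 : ℝ) < L := by exact_mod_cast hL
  have hN' : (0 : ℝ) < N := by exact_mod_cast hN
  obtain ⟨r, hfeas, hopt⟩ := hq
  have hunif : ∀ m : Fin M, 0 ≤ (fun _ : Fin M => p / M) m := fun _ => by positivity
  have hr := hopt (fun _ => p / M) (sensingRate N L R (precodingMatrix U fun _ => p / M))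
    ⟨by rw [one_mul], by
      rw [sub_self, zero_mul]
      exact sumCommRate_nonneg H U hunif, by
      rw [Finset.sum_const, Finset.card_univ, Fintype.card_fin, nsmul_eq_mul,
        mul_div_cancel₀ _ hM'.ne'], hunif⟩
  have hle := hr.trans (by simpa using hfeas.sensing)
  have hqp : ∀ j, q j ≤ p := fun j =>
    (Finset.single_le_sum (fun j _ => hfeas.nonneg j) (Finset.mem_univ j)).trans hfeas.budget
  rw [sensingRate_precodingMatrix N L hU hRU hunif,
    sensingRate_precodingMatrix N L hU hRU hfeas.nonneg,
    mul_le_mul_iff_right₀ (by positivity)] at hle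
  have hpos : ∀ {x : ℝ} (j : Fin M), 0 ≤ x → 0 < 1 + L * (x * eig j) := fun j hx => by
    have := mul_nonneg hL'.le (mul_nonneg hx (heig j).le)
    linarith
  rw [Real.logb_le_logb one_lt_two (Finset.prod_pos fun j _ => hpos j (by positivity))
    (Finset.prod_pos fun j _ => hpos j (hfeas.nonneg j))] at hle
  set X : Fin M → ℝ := fun j => 1 + L * (p * eig j) with hX
  have hXpos : ∀ j, 0 < X j := fun j => hpos j hp.le
  -- Compared with giving full power `p` to everyone, the uniform allocation loses at most a factor
  -- `M` per terminal.
  have hlow : (∏ j, X j) / M ^ M ≤ ∏ j, (1 + L * (p / M * eig j)) := by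
    have h1 : (∏ j, X j) / M ^ M = ∏ j : Fin M, X j / M := by
      rw [Finset.prod_div_distrib, Finset.prod_const, Finset.card_univ, Fintype.card_fin]
    rw [h1]
    refine Finset.prod_le_prod (fun j _ => (div_pos (hXpos j) hM').le) fun j _ => ?_
    rw [hX, div_le_iff₀ hM']
    have : (1 + L * (p / M * eig j)) * M = M + L * (p * eig j) := by field_simp
    rw [this]
    linarith
  -- All factors but the `m`-th are bounded by their full-power values, so the `m`-th must carry the
  -- rest.
  have hupp : ∏ j, (1 + L * (q j * eig j)) ≤
      (1 + L * (q m * eig m)) * ∏ j ∈ Finset.univ.erase m, X j := by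
    rw [← Finset.mul_prod_erase _ _ (Finset.mem_univ m)]
    refine mul_le_mul_of_nonneg_left ?_ (hpos m (hfeas.nonneg m)).le
    refine Finset.prod_le_prod (fun j _ => (hpos j (hfeas.nonneg j)).le) fun j _ => ?_
    have := mul_le_mul_of_nonneg_left
      (mul_le_mul_of_nonneg_right (hqp j) (heig j).le) hL'.le
    simpa [hX] using this
  have hprod : 0 < ∏ j ∈ Finset.univ.erase m, X j := Finset.prod_pos fun j _ => hXpos j
  have hcmp : X m / M ^ M ≤ 1 + L * (q m * eig m) := by
    have := hlow.trans (hle.trans hupp)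
    rw [← Finset.mul_prod_erase _ _ (Finset.mem_univ m), mul_div_right_comm] at this
    exact le_of_mul_le_mul_right this hprod
  have hLe : 0 < L * eig m := mul_pos hL' (heig m)
  have hMM : (0 : ℝ) < M ^ M := by positivity
  rw [sub_le_iff_le_add, ← mul_le_mul_iff_left₀ hLe]
  have h2 : (q m + 1 / (L * eig m)) * (L * eig m) = 1 + L * (q m * eig m) := by
    have := (heig m).ne'
    field_simp
    ring
  rw [h2]
  refine le_trans ?_ hcmp
  rw [div_mul_eq_mul_div]
  refine div_le_div_of_nonneg_right ?_ hMM.le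
  rw [hX]
  linarith

/-- For large power, outage under a Pareto optimal allocation forces all gains to be of the order
of the inverse power. -/
lemma exists_channelGain_lt_of_outage {M : ℕ} {N L : ℕ} (hM : 0 < M) (hN : 0 < N)
    (hL : 0 < L) {R U : Matrix (Fin M) (Fin M) ℂ} {eig : Fin M → ℝ} (heig : ∀ m, 0 < eig m)
    (hU : U ∈ Matrix.unitaryGroup (Fin M) ℂ)
    (hRU : R = U * Matrix.diagonal (fun m => (eig m : ℂ)) * U.conjTranspose)
    {α : ℝ} (hα : α ∈ Set.Icc (0 : ℝ) 1) (R₀ : ℝ) :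
    ∃ c : ℝ, 0 < c ∧ ∀ᶠ p : ℝ in atTop, ∀ (K : ℕ) (H : Fin M → Matrix (Fin K) (Fin M) ℂ)
      (q : Fin M → ℝ), IsParetoPower N L R U H α p q → sumCommRate H U q < R₀ →
      ∀ m, channelGain (H m) U m < c / p := by
  have hM' : (0 : ℝ) < M := by exact_mod_cast hM
  have hL' : (0 : ℝ) < L := by exact_mod_cast hL
  have hN' : (0 : ℝ) < N := by exact_mod_cast hN
  have hpow : (0 : ℝ) < 2 ^ R₀ := Real.rpow_pos_of_pos two_pos _
  rcases hα.2.lt_or_eq with hα1 | rfl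
  · refine ⟨M * 2 ^ R₀, by positivity, ?_⟩
    have hlim : Tendsto (fun p : ℝ => (N : ℝ) / L * Real.logb 2 (p * (L / M * eig ⟨0, hM⟩)))
        atTop atTop := by
      refine Tendsto.const_mul_atTop (by positivity) ?_
      refine (Real.tendsto_logb_atTop one_lt_two).comp ?_
      exact tendsto_id.atTop_mul_const (mul_pos (by positivity) (heig _))
    filter_upwards [hlim.eventually_ge_atTop (α * (R₀ / (1 - α))), eventually_gt_atTop 0]
      with p hlarge hp K H q hq hout m
    have hunif : ∀ m : Fin M, 0 ≤ (fun _ : Fin M => p / M) m := fun _ => by positivity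
    have hterm : ∀ j : Fin M, 0 < p / M * eig j := fun j => mul_pos (by positivity) (heig j)
    have hsens : α * (R₀ / (1 - α)) ≤
        sensingRate N L R (precodingMatrix U fun _ => p / M) := by
      refine hlarge.trans ?_
      rw [sensingRate_precodingMatrix N L hU hRU hunif]
      refine mul_le_mul_of_nonneg_left ?_ (by positivity)
      refine Real.logb_le_logb_of_le one_lt_two
        (mul_pos hp (mul_pos (by positivity) (heig _))) ?_
      calc p * (L / M * eig ⟨0, hM⟩) = L * (p / M * eig ⟨0, hM⟩) := by ring
        _ ≤ 1 + L * (p / M * eig ⟨0, hM⟩) := by linarith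
        _ ≤ ∏ j, (1 + L * (p / M * eig j)) := by
          rw [← Finset.mul_prod_erase _ _ (Finset.mem_univ (⟨0, hM⟩ : Fin M))]
          refine le_mul_of_one_le_right (by have := hterm ⟨0, hM⟩; positivity) ?_
          refine Finset.prod_const_one.ge.trans (Finset.prod_le_prod (fun _ _ => zero_le_one) fun j _ => ?_)
          have := mul_pos hL' (hterm j)
          linarith
    have := channelGain_lt_of_sumCommRate_lt (s := p / M) (by positivity) (fun _ => le_rfl)
      (hq.sumCommRate_uniform_lt hM hα1 hp hsens hout) m
    rwa [div_div_eq_mul_div, mul_comm] at this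
  -- Half of `p / M ^ M` absorbs the term `1 / (L * eig m)` once `p` is large, leaving power at
  -- least `p / (2 * M ^ M)`.
  · refine ⟨2 * M ^ M * 2 ^ R₀, by positivity, ?_⟩
    have hlim : ∀ᶠ p : ℝ in atTop, ∀ m, 1 / (L * eig m) ≤ p / (2 * M ^ M) := by
      rw [eventually_all]
      exact fun m => (tendsto_id.atTop_div_const (by positivity)).eventually_ge_atTop _
    filter_upwards [hlim, eventually_gt_atTop 0] with p hlarge hp K H q hq hout m
    have := channelGain_lt_of_sumCommRate_lt (s := p / (2 * M ^ M)) (by positivity)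
      (fun j => ?_) hout m
    · rwa [div_div_eq_mul_div, mul_comm] at this
    · refine le_trans ?_ (hq.le_power_of_sensing hM hN hL heig hU hRU hp j)
      have h2 : p / (M : ℝ) ^ M = p / (2 * M ^ M) + p / (2 * M ^ M) := by
        field_simp
        ring
      linarith [hlarge j]

/-! ### The law of the gains under Rayleigh fading -/

/-- Right multiplication of a row vector by a unitary matrix, as an isometry. -/
noncomputable def vecMulIsometry {M : ℕ} {U : Matrix (Fin M) (Fin M) ℂ}
    (hU : U ∈ Matrix.unitaryGroup (Fin M) ℂ) :
    EuclideanSpace ℂ (Fin M) ≃ₗᵢ[ℂ] EuclideanSpace ℂ (Fin M) :=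
  LinearIsometry.toLinearIsometryEquiv
    { toFun := fun z => WithLp.toLp 2 (Matrix.vecMul z U)
      map_add' := fun x y => by simp [Matrix.add_vecMul]
      map_smul' := fun c x => by simp [Matrix.smul_vecMul]
      norm_map' := fun z => by
        have hUU : U * star U = 1 := Matrix.mem_unitaryGroup_iff.1 hU
        have h : inner ℂ (WithLp.toLp 2 (Matrix.vecMul z U) : EuclideanSpace ℂ (Fin M))
            (WithLp.toLp 2 (Matrix.vecMul z U)) = inner ℂ z z := by
          rw [EuclideanSpace.inner_eq_star_dotProduct, EuclideanSpace.inner_eq_star_dotProduct,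
            Matrix.star_vecMul, ← Matrix.dotProduct_mulVec, Matrix.mulVec_mulVec]
          change _ ⬝ᵥ ((U * star U).mulVec _) = _
          rw [hUU, Matrix.one_mulVec]
        rw [inner_self_eq_norm_sq_to_K, inner_self_eq_norm_sq_to_K] at h
        exact (sq_eq_sq₀ (norm_nonneg _) (norm_nonneg _)).1 (by exact_mod_cast h) }
    rfl

/-- The columns of the effective channel `H U` of a Gaussian channel `H` are again independent
standard Gaussian vectors. -/
lemma measurePreserving_effective_columns {M K : ℕ} {U : Matrix (Fin M) (Fin M) ℂ}
    (hU : U ∈ Matrix.unitaryGroup (Fin M) ℂ) :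
    MeasurePreserving
      (fun (z : Fin K × Fin M → ℂ) (j : Fin M) (k : Fin K) =>
        ((Matrix.of fun k j => z (k, j) : Matrix (Fin K) (Fin M) ℂ) * U) k j)
      (Measure.pi fun _ => stdComplexGaussian)
      (Measure.pi fun _ => Measure.pi fun _ => stdComplexGaussian) := by
  have h1 := measurePreserving_curry_equiv stdComplexGaussian (Equiv.refl (Fin K × Fin M))
  have h2 := measurePreserving_pi
    (fun _ : Fin K => Measure.pi fun _ : Fin M => stdComplexGaussian)
    (fun _ : Fin K => Measure.pi fun _ : Fin M => stdComplexGaussian)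
    (fun _ => measurePreserving_pi_stdComplexGaussian (vecMulIsometry hU))
  have h3 := MeasurePreserving.symm (MeasurableEquiv.curry (Fin K) (Fin M) ℂ) h1
  have h4 := measurePreserving_curry_equiv stdComplexGaussian
    (Equiv.prodComm (Fin M) (Fin K))
  -- Group the entries by rows, rotate each row by `U`, ungroup, then regroup by columns.
  exact h4.comp (h3.comp (h2.comp h1))

lemma IsRayleighFading.hasLaw {Ω : Type*} [MeasurableSpace Ω] {μ : Measure Ω}
    {M K : ℕ} {H : Fin M → Ω → Matrix (Fin K) (Fin M) ℂ} (hH : IsRayleighFading μ H) :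
    HasLaw (fun ω m (i : Fin K × Fin M) => H m ω i.1 i.2)
      (Measure.pi fun _ => Measure.pi fun _ => stdComplexGaussian) μ := by
  have hmeas : ∀ i : Fin M × Fin K × Fin M, AEMeasurable (fun ω => H i.1 ω i.2.1 i.2.2) μ :=
    fun i => (hH.law i.1 i.2.1 i.2.2).aemeasurable
  have hjoint : HasLaw (fun ω (i : Fin M × Fin K × Fin M) => H i.1 ω i.2.1 i.2.2)
      (Measure.pi fun _ => stdComplexGaussian) μ := by
    refine ⟨aemeasurable_pi_lambda _ hmeas, ?_⟩
    rw [hH.indep.map_fun_eq_pi_map hmeas]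
    congr 1
    ext1 i
    exact (hH.law i.1 i.2.1 i.2.2).map_eq
  exact (measurePreserving_curry_equiv stdComplexGaussian
    (Equiv.refl (Fin M × Fin K × Fin M))).fun_comp_hasLaw hjoint

/-- Under Rayleigh fading the gains are independent, and each has the law of the gain of a
channel with Gaussian columns. -/
lemma IsRayleighFading.measure_forall_channelGain_lt {Ω : Type*} [MeasurableSpace Ω]
    {μ : Measure Ω} {M K : ℕ} {H : Fin M → Ω → Matrix (Fin K) (Fin M) ℂ}
    (hH : IsRayleighFading μ H) {U : Matrix (Fin M) (Fin M) ℂ}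
    (hU : U ∈ Matrix.unitaryGroup (Fin M) ℂ) {t : ℝ} (ht : 0 < t) :
    μ {ω | ∀ m, channelGain (H m ω) U m < t} =
      ∏ m : Fin M, (Measure.pi fun _ : Fin M => Measure.pi fun _ : Fin K => stdComplexGaussian)
        {G | channelGain (Matrix.of fun k j => G j k) 1 m < t} := by
  have hpres := measurePreserving_effective_columns (K := K) hU
  have hS : ∀ m : Fin M, MeasurableSet
      {G : Fin M → Fin K → ℂ | channelGain (Matrix.of fun k j => G j k) 1 m < t} := fun m => by
    rw [setOf_channelGain_lt m ht]
    exact (measurableSet_nearColumns m t).union (measurableSet_dependentColumns _ _)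
  set T : Fin M → Set (Fin K × Fin M → ℂ) := fun m =>
    (fun (z : Fin K × Fin M → ℂ) (j : Fin M) (k : Fin K) =>
        ((Matrix.of fun k j => z (k, j) : Matrix (Fin K) (Fin M) ℂ) * U) k j) ⁻¹'
      {G | channelGain (Matrix.of fun k j => G j k) 1 m < t} with hT
  have h1 : {ω | ∀ m, channelGain (H m ω) U m < t} =
      {ω | (fun m (i : Fin K × Fin M) => H m ω i.1 i.2) ∈ Set.univ.pi T} := by
    ext ω
    simp only [Set.mem_univ_pi, Set.mem_ofPred_eq]
    refine forall_congr' fun m => ?_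
    rw [channelGain_eq_mul_one]
    rfl
  have h2 : μ {ω | (fun m (i : Fin K × Fin M) => H m ω i.1 i.2) ∈ Set.univ.pi T} =
      (Measure.pi fun _ : Fin M => Measure.pi fun _ => stdComplexGaussian) (Set.univ.pi T) :=
    hH.hasLaw.measure_eq (p := fun z => z ∈ Set.univ.pi T)
      (MeasurableSet.univ_pi fun m => hpres.measurable (hS m))
  rw [h1, h2, Measure.pi_pi]
  exact Finset.prod_congr rfl fun m _ => hpres.measure_preimage (hS m).nullMeasurableSet

/-- The probability that all gains are below `t` is of the exact order `t ^ (M (K - M + 1))`. -/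
lemma IsRayleighFading.exists_measureReal_bounds {Ω : Type*} [MeasurableSpace Ω]
    {μ : Measure Ω} [IsProbabilityMeasure μ] {M K : ℕ} (hM : 0 < M) (hKM : M ≤ K)
    {H : Fin M → Ω → Matrix (Fin K) (Fin M) ℂ}
    (hH : IsRayleighFading μ H) {U : Matrix (Fin M) (Fin M) ℂ}
    (hU : U ∈ Matrix.unitaryGroup (Fin M) ℂ) :
    ∃ c C : ℝ, 0 < c ∧ 0 < C ∧ ∀ t : ℝ, 0 < t →
      μ.real {ω | ∀ m, channelGain (H m ω) U m < t} ≤ C * t ^ (M * (K - M + 1)) ∧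
      (t ≤ 1 → c * t ^ (M * (K - M + 1)) ≤
        μ.real {ω | ∀ m, channelGain (H m ω) U m < t}) := by
  obtain ⟨n, rfl⟩ : ∃ n, M = n + 1 := ⟨M - 1, by omega⟩
  have hd : K - (n + 1) + 1 = K - n := by omega
  rw [hd]
  refine ⟨((1 / (72 * (K + 1))) ^ (K - n)) ^ (n + 1), ((n + 2) * 4 ^ (K - n)) ^ (n + 1),
    by positivity, by positivity, fun t ht => ?_⟩
  have hprod := hH.measure_forall_channelGain_lt hU ht
  constructor
  · rw [Measure.real]
    refine ENNReal.toReal_le_of_le_ofReal (by positivity) ?_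
    rw [hprod]
    calc _ ≤ ∏ _m : Fin (n + 1), ENNReal.ofReal ((n + 2) * (4 * t) ^ (K - n)) :=
          Finset.prod_le_prod' fun m _ => measure_channelGain_lt_le hKM m ht
      _ = _ := by
        rw [Finset.prod_const, Finset.card_univ, Fintype.card_fin,
          ← ENNReal.ofReal_pow (by positivity)]
        congr 1
        rw [mul_pow 4 t, ← mul_assoc, mul_pow _ (t ^ (K - n)), ← pow_mul t, mul_comm (K - n)]
  · intro ht1
    rw [Measure.real, ← ENNReal.ofReal_le_iff_le_toReal (measure_ne_top _ _), hprod]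
    calc _ = ∏ _m : Fin (n + 1), ENNReal.ofReal ((t / (72 * (K + 1))) ^ (K - n)) := by
          rw [Finset.prod_const, Finset.card_univ, Fintype.card_fin,
            ← ENNReal.ofReal_pow (by positivity)]
          congr 1
          rw [div_eq_mul_one_div t, mul_pow t, mul_pow (t ^ (K - n)), ← pow_mul t,
            mul_comm (K - n), mul_comm]
      _ ≤ _ := Finset.prod_le_prod' fun m _ => le_measure_channelGain_lt m ht ht1

/-! ### Diversity order -/

/-- A quantity of the exact order `p ^ (-d)` has diversity order `d`. -/
lemma tendsto_neg_log_div_log {f : ℝ → ℝ} {c C d : ℝ} (hc : 0 < c) (hC : 0 < C)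
    (hlow : ∀ᶠ p in atTop, c * p ^ (-d) ≤ f p) (hupp : ∀ᶠ p in atTop, f p ≤ C * p ^ (-d)) :
    Tendsto (fun p => -Real.log (f p) / Real.log p) atTop (𝓝 d) := by
  have hlim : ∀ a : ℝ, Tendsto (fun p : ℝ => d - a / Real.log p) atTop (𝓝 d) := fun a => by
    simpa using tendsto_const_nhds.sub (Real.tendsto_log_atTop.const_div_atTop a)
  have hlog : ∀ {a p : ℝ}, 0 < a → 1 < p →
      Real.log (a * p ^ (-d)) = Real.log a - d * Real.log p := fun ha hp => by
    have hp0 := zero_lt_one.trans hp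
    rw [Real.log_mul ha.ne' (Real.rpow_pos_of_pos hp0 _).ne', Real.log_rpow hp0]
    ring
  have key : ∀ {a p : ℝ}, 1 < p →
      d - a / Real.log p = -(a - d * Real.log p) / Real.log p := fun hp => by
    have := (Real.log_pos hp).ne'
    field_simp
    ring
  refine tendsto_of_tendsto_of_tendsto_of_le_of_le' (hlim (Real.log C)) (hlim (Real.log c)) ?_ ?_
  · filter_upwards [hlow, hupp, eventually_gt_atTop 1] with p h1 h2 hp
    have hpos : 0 < c * p ^ (-d) := mul_pos hc (Real.rpow_pos_of_pos (by linarith) _)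
    rw [key hp, ← hlog hC hp]
    exact div_le_div_of_nonneg_right
      (neg_le_neg (Real.log_le_log (hpos.trans_le h1) h2)) (Real.log_pos hp).le
  · filter_upwards [hlow, eventually_gt_atTop 1] with p h1 hp
    have hpos : 0 < c * p ^ (-d) := mul_pos hc (Real.rpow_pos_of_pos (by linarith) _)
    rw [key hp, ← hlog hc hp]
    exact div_le_div_of_nonneg_right (neg_le_neg (Real.log_le_log hpos h1)) (Real.log_pos hp).le

theorem corollary2 {Ω : Type*} [MeasurableSpace Ω] (μ : Measure Ω) [IsProbabilityMeasure μ]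
    (M K N L : ℕ) (hM : 0 < M) (hKM : M ≤ K) (hN : 0 < N) (hL : 0 < L)
    (H : Fin M → Ω → Matrix (Fin K) (Fin M) ℂ) (hH : IsRayleighFading μ H)
    (R U : Matrix (Fin M) (Fin M) ℂ) (eig : Fin M → ℝ) (hR : R.PosDef)
    (hU : U ∈ Matrix.unitaryGroup (Fin M) ℂ)
    (hRU : R = U * Matrix.diagonal (fun m => (eig m : ℂ)) * U.conjTranspose)
    (α : ℝ) (hα : α ∈ Set.Icc (0 : ℝ) 1) (R₀ : ℝ) (hR₀ : 0 < R₀)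
    (q : ℝ → Ω → Fin M → ℝ)
    (hq : ∀ p : ℝ, 0 < p →
      ∀ᵐ ω ∂μ, IsParetoPower N L R U (fun m => H m ω) α p (q p ω)) :
    ((fun p : ℝ => outageProb μ H U (q p) R₀)
        =O[atTop] fun p : ℝ => p ^ (-((M : ℝ) * ((K : ℝ) - (M : ℝ) + 1)))) ∧
      Tendsto (fun p : ℝ => -Real.log (outageProb μ H U (q p) R₀) / Real.log p) atTop
        (𝓝 ((M : ℝ) * ((K : ℝ) - (M : ℝ) + 1))) := by

  have heig := eigenvalues_pos_of_posDef hR hU hRU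
  obtain ⟨c, C, hc, hC, hbounds⟩ := hH.exists_measureReal_bounds hM hKM hU
  obtain ⟨c₁, hc₁, hout⟩ := exists_channelGain_lt_of_outage hM hN hL heig hU hRU hα R₀
  set e := M * (K - M + 1) with he
  have hd : (M : ℝ) * ((K : ℝ) - M + 1) = e := by
    rw [he]
    push_cast [Nat.cast_sub hKM]
    ring
  rw [hd]
  have hscale : ∀ a p : ℝ, 0 < p → (a / p) ^ e = a ^ e * p ^ (-(e : ℝ)) := fun a p hp => by
    rw [div_pow, Real.rpow_neg hp.le, Real.rpow_natCast, div_eq_mul_inv]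
  -- Gains below `c₀ / p` keep each of the `M` summands below `R₀ / M`.
  set c₀ : ℝ := 2 ^ (R₀ / M) - 1 with hc₀
  have hc₀pos : 0 < c₀ := by
    have hM' : (0 : ℝ) < M := by exact_mod_cast hM
    have := Real.one_lt_rpow one_lt_two (div_pos hR₀ hM')
    rw [hc₀]
    linarith
  have hupp : ∀ᶠ p : ℝ in atTop,
      outageProb μ H U (q p) R₀ ≤ C * c₁ ^ e * p ^ (-(e : ℝ)) := by
    filter_upwards [hout, eventually_gt_atTop 0] with p hp hp0
    rw [mul_assoc, ← hscale c₁ p hp0]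
    refine le_trans ?_ (hbounds (c₁ / p) (div_pos hc₁ hp0)).1
    -- Only monotonicity of the measure is used, so the outage event need not be measurable.
    refine ENNReal.toReal_mono (measure_ne_top _ _) (measure_mono_ae ?_)
    filter_upwards [hq p hp0] with ω hω hlt
    exact hp K (fun m => H m ω) (q p ω) hω hlt
  have hlow : ∀ᶠ p : ℝ in atTop,
      c * c₀ ^ e * p ^ (-(e : ℝ)) ≤ outageProb μ H U (q p) R₀ := by
    filter_upwards [eventually_ge_atTop c₀, eventually_gt_atTop 0] with p hp hp0
    rw [mul_assoc, ← hscale c₀ p hp0]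
    refine le_trans ((hbounds (c₀ / p) (div_pos hc₀pos hp0)).2 ((div_le_one hp0).2 hp)) ?_
    refine ENNReal.toReal_mono (measure_ne_top _ _) (measure_mono_ae ?_)
    filter_upwards [hq p hp0] with ω hω hlt
    obtain ⟨r, hfeas, -⟩ := hω
    exact sumCommRate_lt_of_channelGain_lt hM hp0 hfeas.nonneg hfeas.budget hlt
  refine ⟨?_, tendsto_neg_log_div_log (by positivity) (by positivity) hlow hupp⟩
  refine IsBigO.of_bound (C * c₁ ^ e) ?_
  filter_upwards [hupp, eventually_gt_atTop 0] with p hp hp0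
  rwa [outageProb, Real.norm_of_nonneg measureReal_nonneg,
    Real.norm_of_nonneg (Real.rpow_nonneg hp0.le _)]
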